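/- Let $\mathbb{K}=\mathbb{R}$ or $\mathbb{K}=\mathbb{C}$, let $A\in\mathbb{K}^{n\times n}$ be self-adjoint with eigenvalues $\lambda_1\ge\dots\ge\lambda_n$ (counted with multiplicity), and let $A=X\,\mathrm{diag}(\lambda_1,\dots,\lambda_n)\,X^*$ be an eigendecomposition, where $X$ is unitary with columns $x_1,\dots,x_n$. Put $\mathcal{X}_l=\mathrm{span}\{x_1,\dots,x_l\}$ for $0\le l\le n$ (so $\mathcal{X}_0=\{0\}$), and $\lambda_0=\infty$, $\lambda_{n+1}=-\infty$. Let $0\le j<h<k\le n$ be such that $\lambda_j>\lambda_{j+1}$ and $\lambda_k>\lambda_{k+1}$, and let $$\Lambda\text{-adm}_h(A)=\{\mathcal{S}\subset\mathbb{K}^n \text{ a subspace}:\ \dim\mathcal{S}=h,\ \mathcal{X}_j\subseteq\mathcal{S}\subseteq\mathcal{X}_k\}$$ be the class of $h$-dimensional $\Lambda$-admissible subspaces of $A$. For subspaces $\mathcal{S},\mathcal{T}\subset\mathbb{K}^n$ with $m=\min\{\dim\mathcal{S},\dim\mathcal{T}\}$, let $S$ and $T$ be matrices whose columns form orthonormal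 bases of $\mathcal{S}$ and $\mathcal{T}$. The principal angles $0\le\theta_1(\mathcal{S},\mathcal{T})\le\dots\le\theta_m(\mathcal{S},\mathcal{T})\le\frac{\pi}{2}$ are defined by $\cos\theta_i(\mathcal{S},\mathcal{T})=\sigma_i(S^*T)$, where $\sigma_1\ge\dots\ge\sigma_m$ denote the singular values, and $\sin\Theta(\mathcal{S},\mathcal{T})=\mathrm{diag}(\sin\theta_1,\dots,\sin\theta_m,0,\dots,0)\in\mathbb{K}^{n\times n}$. A norm $\|\cdot\|$ on $\mathbb{K}^{n\times n}$ is unitarily invariant if $\|UMV\|=\|M\|$ for all $M$ and all unitary (orthogonal, if $\mathbb{K}=\mathbb{R}$) $U,V$. Let $\mathcal{T}\subset\mathbb{K}^n$ be a subspace such that all the principal angles between $\mathcal{X}_k$ and $\mathcal{T}$ are strictly smaller than $\frac{\pi}{2}$. Then for every unitarily invariant norm $\|\cdot\|$ on $\mathbb{K}^{n\times n}$, $$d(\Lambda\text{-adm}_h(A),\mathcal{T}):=\inf_{\mathcal{S}\in\Lambda\text{-adm}_h(A)}\|\sin\Theta(\mathcal{S},\mathcal{T})\|\ \le\ \|\sin\Theta(\mathcal{X}_j,\mathcal{T})\|+\|\sin\Theta(\mathcal{X}_k,\mathcal{T})\|.$$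 Moreover, there is a subspace $\mathcal{S}\in\Lambda\text{-adm}_h(A)$, not depending on the norm, such that $\|\sin\Theta(\mathcal{S},\mathcal{T})\|\le\|\sin\Theta(\mathcal{X}_j,\mathcal{T})\|+\|\sin\Theta(\mathcal{X}_k,\mathcal{T})\|$ for every unitarily invariant norm $\|\cdot\|$ on $\mathbb{K}^{n\times n}$. -/

import Mathlib

noncomputable section

/-- The linear map `T → S`, `x ↦ P_S x`. In orthonormal bases of `S` and `T`, given by the columns
of matrices `S` and `T`, its matrix is `S^* T`. -/
def crossProjection {𝕜 : Type*} [RCLike 𝕜] {n : ℕ}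
    (S T : Submodule 𝕜 (EuclideanSpace 𝕜 (Fin n))) : T →ₗ[𝕜] S :=
  (S.orthogonalProjectionOnto : EuclideanSpace 𝕜 (Fin n) →ₗ[𝕜] S) ∘ₗ T.subtype

/-- The number of principal angles between `S` and `T`. -/
def numAngles {𝕜 : Type*} [RCLike 𝕜] {n : ℕ}
    (S T : Submodule 𝕜 (EuclideanSpace 𝕜 (Fin n))) : ℕ :=
  min (Module.finrank 𝕜 S) (Module.finrank 𝕜 T)

/-- The principal angles `θ_{i+1}(S, T) ∈ [0, π/2]`, defined by
`cos θ_{i+1}(S, T) = σ_{i+1}(S^* T)`; in non-decreasing order, and counted from zero. Only the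
indices `i < numAngles S T` are meaningful. -/
def principalAngle {𝕜 : Type*} [RCLike 𝕜] {n : ℕ}
    (S T : Submodule 𝕜 (EuclideanSpace 𝕜 (Fin n))) (i : ℕ) : ℝ :=
  Real.arccos (LinearMap.singularValues (𝕜 := 𝕜) (E := T) (F := S) (crossProjection S T) i)

/-- The diagonal matrix `sin Θ(S, T)`, completed by zeros to an `n × n` matrix, so that norms on
`n × n` matrices apply to it. -/
def sinTheta {𝕜 : Type*} [RCLike 𝕜] {n : ℕ}
    (S T : Submodule 𝕜 (EuclideanSpace 𝕜 (Fin n))) : Matrix (Fin n) (Fin n) 𝕜 :=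
  Matrix.diagonal fun i : Fin n =>
    if (i : ℕ) < numAngles S T then ((Real.sin (principalAngle S T i) : ℝ) : 𝕜) else 0

/-- Unitarily invariant norms on `n × n` matrices. -/
structure IsUnitarilyInvariantNorm {𝕜 : Type*} [RCLike 𝕜] {n : ℕ}
    (N : Matrix (Fin n) (Fin n) 𝕜 → ℝ) : Prop where
  nonneg : ∀ M, 0 ≤ N M
  eq_zero_iff : ∀ M, N M = 0 ↔ M = 0
  smul : ∀ (c : 𝕜) M, N (c • M) = ‖c‖ * N M
  add_le : ∀ M M', N (M + M') ≤ N M + N M'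
  unitary_mul_mul : ∀ U ∈ Matrix.unitaryGroup (Fin n) 𝕜, ∀ V ∈ Matrix.unitaryGroup (Fin n) 𝕜,
    ∀ M, N (U * M * V) = N M

/-- `A = X Λ X^*` is an eigendecomposition: `X` is unitary and `Λ` is the diagonal matrix of the
real numbers `lam 0 ≥ lam 1 ≥ ... ≥ lam (n - 1)`. -/
structure IsEigendecomposition {𝕜 : Type*} [RCLike 𝕜] {n : ℕ}
    (A X : Matrix (Fin n) (Fin n) 𝕜) (lam : Fin n → ℝ) : Prop where
  unitary : X ∈ Matrix.unitaryGroup (Fin n) 𝕜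
  antitone : Antitone lam
  eq_mul : A = X * Matrix.diagonal (fun i => ((lam i : ℝ) : 𝕜)) * X.conjTranspose

/-- The span `X_l` of the first `l` columns of `X`. -/
def leadingSpan {𝕜 : Type*} [RCLike 𝕜] {n : ℕ}
    (X : Matrix (Fin n) (Fin n) 𝕜) (l : ℕ) : Submodule 𝕜 (EuclideanSpace 𝕜 (Fin n)) :=
  Submodule.span 𝕜 {x | ∃ i : Fin n, (i : ℕ) < l ∧ x = WithLp.toLp 2 (X.col i)}

/-- The eigen-gap `λ_l > λ_{l+1}` at `l` (in the numbering `λ_1, ..., λ_n`, so that `λ_l` is the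
entry of `lam` at the index `l - 1`). With `λ_0 = ∞` and `λ_{n+1} = -∞` there is always a gap at
`0` and at `n`. -/
def HasEigenGap {n : ℕ} (lam : Fin n → ℝ) (l : ℕ) : Prop :=
  ∀ i i' : Fin n, (i : ℕ) + 1 = l → (i' : ℕ) = l → lam i' < lam i

/-- The class `Λ-adm_h(A)` for the indices `j < h < k`, where `X` is the unitary matrix of an
eigendecomposition of `A`. -/
def admissibleSubspaces {𝕜 : Type*} [RCLike 𝕜] {n : ℕ}
    (X : Matrix (Fin n) (Fin n) 𝕜) (j h k : ℕ) : Set (Submodule 𝕜 (EuclideanSpace 𝕜 (Fin n))) :=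
  {S | Module.finrank 𝕜 S = h ∧ leadingSpan X j ≤ S ∧ S ≤ leadingSpan X k}

/-- The distance `d(C, T) = inf {N(sin Θ(S, T)) : S ∈ C}`. -/
def classDist {𝕜 : Type*} [RCLike 𝕜] {n : ℕ} (N : Matrix (Fin n) (Fin n) 𝕜 → ℝ)
    (C : Set (Submodule 𝕜 (EuclideanSpace 𝕜 (Fin n))))
    (T : Submodule 𝕜 (EuclideanSpace 𝕜 (Fin n))) : ℝ :=
  sInf ((fun S => N (sinTheta S T)) '' C)

end

/-! For a unitarily invariant norm, `sin Θ(S, T)` has the norm of `P_{Tᗮ} P_S` or `P_{Sᗮ} P_T`, with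
the space of smaller dimension on the right. In equal dimensions both apply, so the two products
have equal norms. Let `P ≤ Q` be the two leading spans. If `dim T ≤ dim P` or `dim T ≥ dim Q`,
monotonicity makes every `S` between them work. Otherwise the intermediate space is `T' = P_Q T`, of
dimension `dim T` because the angles are acute. It satisfies `P_{T'ᗮ} P_T = P_{Qᗮ} P_T`, and
`P_{T'ᗮ} P_P` is no larger than `P_{Tᗮ} P_P`. Adding to `P` vectors of `T'` orthogonal to `P` leaves
`P_{T'ᗮ} P_P` unchanged; this gives `S`, filled up arbitrarily inside `Q` if `h > dim T`. The
triangle inequality through `T'` yields the bound, and no choice involves the norm. -/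

open Module
open scoped InnerProductSpace

/-! ### Orthonormal extensions and singular vectors -/

section Extension

variable {𝕜 E : Type*} [RCLike 𝕜] [NormedAddCommGroup E] [InnerProductSpace 𝕜 E]
  [FiniteDimensional 𝕜 E]

/-- An orthogonal family indexed by the dimension, with prescribed norms, is a multiple of an
orthonormal basis. -/
theorem exists_orthonormalBasis_smul_eq {ι : Type*} [Fintype ι] [DecidableEq ι]
    (hι : finrank 𝕜 E = Fintype.card ι) (w : ι → E) (d : ι → ℝ)
    (hw : ∀ i j, ⟪w i, w j⟫_𝕜 = if i = j then ((d i ^ 2 : ℝ) : 𝕜) else 0) :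
    ∃ u : OrthonormalBasis ι 𝕜 E, ∀ i, w i = (d i : 𝕜) • u i := by
  -- Indices with `d i = 0` have `w i = 0` and impose no condition on `u i`, so only the others are
  -- normalised.
  have horth : Orthonormal 𝕜 ({i | d i ≠ 0}.domRestrict fun i => ((d i : 𝕜)⁻¹) • w i) := by
    rw [orthonormal_iff_ite]
    rintro ⟨i, hi⟩ ⟨j, hj⟩
    have hi' : (d i : 𝕜) ≠ 0 := by exact_mod_cast hi
    simp only [Set.domRestrict_apply, inner_smul_left, inner_smul_right, hw, Subtype.mk.injEq]
    split_ifs with h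
    · subst h
      simp only [map_inv₀, RCLike.conj_ofReal, RCLike.ofReal_pow]
      field_simp
    · simp
  obtain ⟨u, hu⟩ := horth.exists_orthonormalBasis_extension_of_card_eq hι
  refine ⟨u, fun i => ?_⟩
  by_cases hi : d i = 0
  · have := hw i i
    simp only [hi, if_true] at this
    simp only [hi, RCLike.ofReal_zero, zero_smul]
    exact inner_self_eq_zero.1 (this.trans (by simp))
  · have hi' : (d i : 𝕜) ≠ 0 := by exact_mod_cast hi
    rw [hu i hi, smul_inv_smul₀ hi']

theorem exists_submodule_between_finrank_eq {K V : Type*} [DivisionRing K] [AddCommGroup V]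
    [Module K V] [FiniteDimensional K V] {P Q : Submodule K V} (hPQ : P ≤ Q) {h : ℕ}
    (hP : finrank K P ≤ h) (hQ : h ≤ finrank K Q) :
    ∃ S : Submodule K V, P ≤ S ∧ S ≤ Q ∧ finrank K S = h := by
  induction h, hP using Nat.le_induction with
  | base => exact ⟨P, le_rfl, hPQ, rfl⟩
  | succ m hm ih =>
    obtain ⟨S, hPS, hSQ, hS⟩ := ih (by omega)
    have hne : ¬ Q ≤ S := fun hle => by
      have := Submodule.finrank_mono hle
      omega
    obtain ⟨x, hxQ, hxS⟩ := SetLike.not_le_iff_exists.1 hne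
    refine ⟨S ⊔ Submodule.span K {x}, hPS.trans le_sup_left,
      sup_le hSQ (by simpa [Submodule.span_le] using hxQ), ?_⟩
    rw [Submodule.finrank_sup_span_singleton hxS, hS]

variable {F : Type*} [NormedAddCommGroup F] [InnerProductSpace 𝕜 F] [FiniteDimensional 𝕜 F]

/-- Right singular vectors. -/
theorem LinearMap.exists_orthonormalBasis_inner_map (f : E →ₗ[𝕜] F) {n : ℕ}
    (hn : finrank 𝕜 E = n) :
    ∃ v : OrthonormalBasis (Fin n) 𝕜 E, ∀ i j, ⟪f (v i), f (v j)⟫_𝕜 =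
      if i = j then ((f.singularValues i ^ 2 : ℝ) : 𝕜) else 0 := by
  refine ⟨f.isSymmetric_adjoint_comp_self.eigenvectorBasis hn, fun i j => ?_⟩
  rw [← LinearMap.adjoint_inner_right, ← LinearMap.comp_apply,
    LinearMap.IsSymmetric.apply_eigenvectorBasis, inner_smul_right,
    orthonormal_iff_ite.1 (OrthonormalBasis.orthonormal _), f.sq_singularValues_fin hn]
  split_ifs with h <;> simp [h]

/-- Left singular vectors. -/
theorem LinearMap.exists_orthonormalBasis_inner_adjoint (f : E →ₗ[𝕜] F) {m : ℕ}
    (hm : finrank 𝕜 F = m) :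
    ∃ u : OrthonormalBasis (Fin m) 𝕜 F, ∀ i j,
      ⟪LinearMap.adjoint f (u i), LinearMap.adjoint f (u j)⟫_𝕜 =
        if i = j then ((f.singularValues i ^ 2 : ℝ) : 𝕜) else 0 := by
  obtain ⟨n, hn⟩ : ∃ n, finrank 𝕜 E = n := ⟨_, rfl⟩
  obtain ⟨v, hv⟩ := f.exists_orthonormalBasis_inner_map hn
  -- Padding by zero lets one index run over both spaces, whose dimensions may differ.
  let v' : ℕ → E := fun i => if h : i < n then v ⟨i, h⟩ else 0
  have hv' : ∀ i j, ⟪f (v' i), f (v' j)⟫_𝕜 =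
      if i = j then ((f.singularValues i ^ 2 : ℝ) : 𝕜) else 0 := by
    intro i j
    by_cases hi : i < n
    · by_cases hj : j < n
      · simp only [v', hi, hj, dif_pos, hv, Fin.mk.injEq]
      · have : i ≠ j := by omega
        simp [v', hj, this]
    · have : f.singularValues i = 0 := f.singularValues_of_finrank_le (hn.le.trans (not_lt.1 hi))
      simp [v', hi, this]
  obtain ⟨u, hu⟩ := exists_orthonormalBasis_smul_eq (𝕜 := 𝕜) (by simp [hm])
    (fun i : Fin m => f (v' i)) (fun i => f.singularValues i) (fun i j => by
      simp only [hv', Fin.ext_iff])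
  have hrank : finrank 𝕜 f.range ≤ m := hm ▸ Submodule.finrank_le _
  -- Tested against the basis `v`. For `l ≥ m` the rank bound gives `f (v' l) = 0`.
  have hadj : ∀ i : Fin m, LinearMap.adjoint f (u i) = (f.singularValues i : 𝕜) • v' i := by
    intro i
    refine InnerProductSpace.ext_inner_left_basis v.toBasis fun l => ?_
    have hl : v.toBasis l = v' l := by simp [v', l.2]
    rw [hl, LinearMap.adjoint_inner_right, inner_smul_right]
    have hvv : ⟪v' l, v' i⟫_𝕜 = if (l : ℕ) = i then 1 else 0 := by
      by_cases hi : (i : ℕ) < n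
      · simp only [v', l.2, hi, dif_pos, orthonormal_iff_ite.1 v.orthonormal, Fin.ext_iff]
      · have : (l : ℕ) ≠ i := by omega
        simp [v', hi, this]
    rw [hvv]
    by_cases hlm : (l : ℕ) < m
    · have := hu ⟨l, hlm⟩
      simp only at this
      rw [this, inner_smul_left, orthonormal_iff_ite.1 u.orthonormal]
      by_cases h : (l : ℕ) = i <;> simp [h, Fin.ext_iff]
    · have h0 : f.singularValues l = 0 :=
        f.singularValues_eq_zero_iff_le_finrank_range.2 (by omega)
      have h1 : f (v' l) = 0 := by
        rw [← inner_self_eq_zero (𝕜 := 𝕜), hv', if_pos rfl, h0]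
        simp
      have : (l : ℕ) ≠ i := by omega
      simp [h1, this]
  refine ⟨u, fun i j => ?_⟩
  rw [hadj, inner_smul_left, LinearMap.adjoint_inner_right]
  have := hu i
  beta_reduce at this
  rw [this, inner_smul_left, orthonormal_iff_ite.1 u.orthonormal]
  split_ifs <;> simp [pow_two]

end Extension

/-! ### Unitarily invariant norms, and sines as products of projections -/

section Norm

variable {𝕜 : Type*} [RCLike 𝕜] {n : ℕ}

local notation "𝔼" => EuclideanSpace 𝕜 (Fin n)

/-- A function on matrices, evaluated at the matrix of an operator in the standard basis. -/
noncomputable def matNorm (N : Matrix (Fin n) (Fin n) 𝕜 → ℝ) (f : 𝔼 →ₗ[𝕜] 𝔼) : ℝ :=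
  N (LinearMap.toMatrix (EuclideanSpace.basisFun (Fin n) 𝕜).toBasis
    (EuclideanSpace.basisFun (Fin n) 𝕜).toBasis f)

/-- The orthogonal projection as a linear map. -/
noncomputable def projMap (K : Submodule 𝕜 𝔼) : 𝔼 →ₗ[𝕜] 𝔼 := K.starProjection

theorem projMap_apply (K : Submodule 𝕜 𝔼) (x : 𝔼) : projMap K x = K.starProjection x := rfl

theorem toMatrix_mul_toMatrix (b : Module.Basis (Fin n) 𝕜 𝔼) (f g : 𝔼 →ₗ[𝕜] 𝔼) :
    LinearMap.toMatrix b b (f ∘ₗ g) = LinearMap.toMatrix b b f * LinearMap.toMatrix b b g :=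
  LinearMap.toMatrix_comp _ _ _ _ _

namespace IsUnitarilyInvariantNorm

variable {N : Matrix (Fin n) (Fin n) 𝕜 → ℝ}

theorem matNorm_add_le (hN : IsUnitarilyInvariantNorm N) (f g : 𝔼 →ₗ[𝕜] 𝔼) :
    matNorm N (f + g) ≤ matNorm N f + matNorm N g := by
  simp only [matNorm, map_add]
  exact hN.add_le _ _

theorem matNorm_smul (hN : IsUnitarilyInvariantNorm N) (c : 𝕜) (f : 𝔼 →ₗ[𝕜] 𝔼) :
    matNorm N (c • f) = ‖c‖ * matNorm N f := by
  simp only [matNorm, map_smul]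
  exact hN.smul _ _

theorem matNorm_isometry_comp (hN : IsUnitarilyInvariantNorm N) (U : 𝔼 ≃ₗᵢ[𝕜] 𝔼)
    (f : 𝔼 →ₗ[𝕜] 𝔼) : matNorm N ((U : 𝔼 →ₗ[𝕜] 𝔼) ∘ₗ f) = matNorm N f := by
  have := hN.unitary_mul_mul _ (U.toMatrix_mem_unitaryGroup (EuclideanSpace.basisFun (Fin n) 𝕜)
    (EuclideanSpace.basisFun (Fin n) 𝕜)) 1 (one_mem _)
  rw [matNorm, toMatrix_mul_toMatrix]
  exact (congrArg N (mul_one _).symm).trans (this _)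

theorem matNorm_comp_isometry (hN : IsUnitarilyInvariantNorm N) (U : 𝔼 ≃ₗᵢ[𝕜] 𝔼)
    (f : 𝔼 →ₗ[𝕜] 𝔼) : matNorm N (f ∘ₗ (U : 𝔼 →ₗ[𝕜] 𝔼)) = matNorm N f := by
  have := hN.unitary_mul_mul 1 (one_mem _) _
    (U.toMatrix_mem_unitaryGroup (EuclideanSpace.basisFun (Fin n) 𝕜)
    (EuclideanSpace.basisFun (Fin n) 𝕜))
  rw [matNorm, toMatrix_mul_toMatrix]
  exact (congrArg N (congrArg (· * _) (one_mul _).symm)).trans (this _)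

/-- A projection is the average of two isometries, so composing with it on either side cannot
increase a unitarily invariant norm. -/
theorem projMap_eq_smul (K : Submodule 𝕜 𝔼) :
    projMap K = (2⁻¹ : 𝕜) • (LinearMap.id + (K.reflection : 𝔼 →ₗ[𝕜] 𝔼)) := by
  ext1 x
  have : (K.reflection : 𝔼 →ₗ[𝕜] 𝔼) x = (2 : 𝕜) • K.starProjection x - x := by
    rw [two_smul, ← two_nsmul]
    exact K.reflection_apply x
  rw [LinearMap.smul_apply, LinearMap.add_apply, this, LinearMap.id_apply, add_sub_cancel,
    inv_smul_smul₀ two_ne_zero, projMap_apply]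

theorem matNorm_projMap_comp_le (hN : IsUnitarilyInvariantNorm N) (K : Submodule 𝕜 𝔼)
    (f : 𝔼 →ₗ[𝕜] 𝔼) : matNorm N (projMap K ∘ₗ f) ≤ matNorm N f := by
  rw [projMap_eq_smul, LinearMap.smul_comp, hN.matNorm_smul, LinearMap.add_comp,
    LinearMap.id_comp]
  have h1 := hN.matNorm_add_le f ((K.reflection : 𝔼 →ₗ[𝕜] 𝔼) ∘ₗ f)
  rw [hN.matNorm_isometry_comp] at h1
  rw [norm_inv, RCLike.norm_ofNat]
  linarith

theorem matNorm_comp_projMap_le (hN : IsUnitarilyInvariantNorm N) (K : Submodule 𝕜 𝔼)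
    (f : 𝔼 →ₗ[𝕜] 𝔼) : matNorm N (f ∘ₗ projMap K) ≤ matNorm N f := by
  rw [projMap_eq_smul, LinearMap.comp_smul, hN.matNorm_smul, LinearMap.comp_add,
    LinearMap.comp_id]
  have h1 := hN.matNorm_add_le f (f ∘ₗ (K.reflection : 𝔼 →ₗ[𝕜] 𝔼))
  rw [hN.matNorm_comp_isometry] at h1
  rw [norm_inv, RCLike.norm_ofNat]
  linarith

/-- An operator mapping an orthonormal basis `b` to the vectors `d i • u i`, for another
orthonormal basis `u`, has the norm of the diagonal matrix of the `d i`. -/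
theorem matNorm_eq_diagonal (hN : IsUnitarilyInvariantNorm N) (b : OrthonormalBasis (Fin n) 𝕜 𝔼)
    (f : 𝔼 →ₗ[𝕜] 𝔼) (d : Fin n → ℝ)
    (hf : ∀ i j, ⟪f (b i), f (b j)⟫_𝕜 = if i = j then ((d i ^ 2 : ℝ) : 𝕜) else 0) :
    matNorm N f = N (Matrix.diagonal fun i => (d i : 𝕜)) := by
  obtain ⟨u, hu⟩ := exists_orthonormalBasis_smul_eq (𝕜 := 𝕜) (by simp) (fun i => f (b i)) d hf
  set e := EuclideanSpace.basisFun (Fin n) 𝕜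
  rw [← hN.matNorm_comp_isometry (e.equiv b (Equiv.refl _)),
    ← hN.matNorm_isometry_comp (u.equiv e (Equiv.refl _)), matNorm]
  congr 1
  refine Matrix.ext fun i j => ?_
  have h1 : u.equiv e (Equiv.refl _) (f (e.equiv b (Equiv.refl _) (e j))) = (d j : 𝕜) • e j := by
    rw [OrthonormalBasis.equiv_apply_basis, Equiv.refl_apply, hu j, map_smul,
      OrthonormalBasis.equiv_apply_basis, Equiv.refl_apply]
  rw [LinearMap.toMatrix_apply, OrthonormalBasis.coe_toBasis]
  change e.toBasis.repr (u.equiv e (Equiv.refl _) (f (e.equiv b (Equiv.refl _) (e j)))) i = _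
  rw [h1, OrthonormalBasis.coe_toBasis_repr_apply, map_smul, OrthonormalBasis.repr_self,
    PiLp.smul_apply, PiLp.single_apply, Matrix.diagonal_apply]
  split_ifs with h <;> simp [h]

/-- The matrix of the sines of the angles with cosines `σ i` is unitarily equivalent to
`P_{Lᗮ} P_K`. -/
theorem diagonal_sin_eq (hN : IsUnitarilyInvariantNorm N) (K L : Submodule 𝕜 𝔼) {m : ℕ}
    (u : OrthonormalBasis (Fin m) 𝕜 K) (σ : ℕ → ℝ)
    (hu : ∀ i j, ⟪L.starProjection (u i : 𝔼), L.starProjection (u j : 𝔼)⟫_𝕜 =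
      if i = j then ((σ i ^ 2 : ℝ) : 𝕜) else 0) :
    N (Matrix.diagonal fun i : Fin n =>
      if (i : ℕ) < m then ((Real.sin (Real.arccos (σ i)) : ℝ) : 𝕜) else 0) =
    matNorm N (projMap Lᗮ ∘ₗ projMap K) := by
  have hmn : m ≤ n := by
    have h1 := Submodule.finrank_le K
    rwa [finrank_eq_card_basis u.toBasis, Fintype.card_fin, finrank_euclideanSpace_fin] at h1
  let w : Fin n → 𝔼 := fun i => if h : (i : ℕ) < m then u ⟨i, h⟩ else 0
  have hw : Orthonormal 𝕜 ({i : Fin n | (i : ℕ) < m}.domRestrict w) := by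
    rw [orthonormal_iff_ite]
    rintro ⟨i, hi⟩ ⟨j, hj⟩
    simp only [Set.mem_ofPred_eq] at hi hj
    have := orthonormal_iff_ite.1 u.orthonormal ⟨i, hi⟩ ⟨j, hj⟩
    rw [Submodule.coe_inner] at this
    simp only [Set.domRestrict_apply, w, hi, hj, dif_pos, this, Subtype.mk.injEq,
      Fin.ext_iff]
  obtain ⟨b, hb⟩ := hw.exists_orthonormalBasis_extension_of_card_eq (by simp)
  have hbm : ∀ i : Fin n, ∀ hi : (i : ℕ) < m, b i = u ⟨i, hi⟩ := fun i hi => by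
    rw [hb i hi]
    simp [w, hi]
  have hK : ∀ i : Fin n, ∀ hi : (i : ℕ) < m, projMap K (b i) = u ⟨i, hi⟩ := fun i hi => by
    rw [hbm i hi, projMap_apply, Submodule.starProjection_eq_self_iff]
    exact Subtype.coe_prop _
  have hK0 : ∀ i : Fin n, ¬ (i : ℕ) < m → projMap K (b i) = 0 := fun i hi => by
    rw [projMap_apply, Submodule.starProjection_apply_eq_zero_iff,
      Submodule.mem_orthogonal]
    intro x hx
    have hx' := congrArg (Subtype.val) (u.sum_repr ⟨x, hx⟩)
    simp only [Submodule.coe_sum, Submodule.coe_smul] at hx'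
    rw [← hx', sum_inner]
    refine Finset.sum_eq_zero fun l _ => ?_
    have := hbm ⟨l, l.2.trans_le hmn⟩ l.2
    rw [inner_smul_left, ← this, orthonormal_iff_ite.1 b.orthonormal, if_neg, mul_zero]
    rintro rfl
    exact hi l.2
  -- Pythagoras: the Gram matrices of the components in `L` and in `Lᗮ` add up to the identity.
  have hval : ∀ i j : Fin m, ⟪Lᗮ.starProjection (u i : 𝔼), Lᗮ.starProjection (u j : 𝔼)⟫_𝕜 =
      if i = j then ((1 - σ i ^ 2 : ℝ) : 𝕜) else 0 := by
    intro i j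
    have h1 := orthonormal_iff_ite.1 u.orthonormal i j
    rw [Submodule.coe_inner] at h1
    have h2 := hu i j
    rw [Submodule.inner_starProjection_left_eq_right, Submodule.starProjection_eq_self_iff.2
      (Submodule.starProjection_apply_mem _ _)] at h2
    rw [Submodule.inner_starProjection_left_eq_right, Submodule.starProjection_eq_self_iff.2
      (Submodule.starProjection_apply_mem _ _), Submodule.starProjection_orthogonal_val,
      inner_sub_right, h1, h2]
    split_ifs <;> simp
  -- `Real.sin_arccos` gives a `Real.sqrt`, which squares back only for a nonnegative radicand.
  have hσ : ∀ i : Fin m, 0 ≤ 1 - σ i ^ 2 := fun i => by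
    have := hval i i
    rw [if_pos rfl, inner_self_eq_norm_sq_to_K] at this
    have h3 : ‖Lᗮ.starProjection (u i : 𝔼)‖ ^ 2 = 1 - σ i ^ 2 := by exact_mod_cast this
    rw [← h3]
    positivity
  rw [hN.matNorm_eq_diagonal b _ fun i : Fin n =>
    if (i : ℕ) < m then Real.sin (Real.arccos (σ i)) else 0]
  · congr 2
    ext i
    split_ifs <;> simp
  · intro i j
    simp only [LinearMap.comp_apply]
    by_cases hi : (i : ℕ) < m
    · by_cases hj : (j : ℕ) < m
      · rw [hK i hi, hK j hj, projMap_apply, projMap_apply, hval, Real.sin_arccos]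
        simp only [hi, if_true, Fin.ext_iff]
        rw [Real.sq_sqrt (hσ ⟨i, hi⟩)]
      · rw [hK0 j hj, if_neg (by rintro rfl; exact hj hi)]
        simp
    · rw [hK0 i hi]
      simp [hi]

theorem inner_crossProjection (S T : Submodule 𝕜 𝔼) (x y : T) :
    ⟪crossProjection S T x, crossProjection S T y⟫_𝕜 =
      ⟪S.starProjection (x : 𝔼), S.starProjection (y : 𝔼)⟫_𝕜 := by
  rw [Submodule.coe_inner]
  rfl

theorem adjoint_crossProjection (S T : Submodule 𝕜 𝔼) :
    LinearMap.adjoint (𝕜 := 𝕜) (E := T) (F := S) (crossProjection S T) = crossProjection T S := by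
  symm
  refine (LinearMap.eq_adjoint_iff (𝕜 := 𝕜) (E := S) (F := T) _ _).2 fun x y => ?_
  change ⟪T.orthogonalProjectionOnto (x : 𝔼), y⟫_𝕜 = ⟪x, S.orthogonalProjectionOnto (y : 𝔼)⟫_𝕜
  rw [Submodule.inner_orthogonalProjectionOnto_eq_of_mem_right,
    Submodule.inner_orthogonalProjectionOnto_eq_of_mem_left]

theorem sinTheta_of_finrank_ge (hN : IsUnitarilyInvariantNorm N) {S T : Submodule 𝕜 𝔼}
    (h : finrank 𝕜 T ≤ finrank 𝕜 S) :
    N (sinTheta S T) = matNorm N (projMap Sᗮ ∘ₗ projMap T) := by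
  obtain ⟨v, hv⟩ := LinearMap.exists_orthonormalBasis_inner_map (𝕜 := 𝕜) (E := T) (F := S)
    (crossProjection S T) rfl
  have := hN.diagonal_sin_eq T S v _
    (fun i j => (inner_crossProjection S T _ _).symm.trans (hv i j))
  rw [← this, sinTheta, numAngles, min_eq_right h]
  rfl

/-- Here the left singular vectors are needed: they form a basis of the smaller space `S`. -/
theorem sinTheta_of_finrank_le (hN : IsUnitarilyInvariantNorm N) {S T : Submodule 𝕜 𝔼}
    (h : finrank 𝕜 S ≤ finrank 𝕜 T) :
    N (sinTheta S T) = matNorm N (projMap Tᗮ ∘ₗ projMap S) := by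
  obtain ⟨v, hv⟩ := LinearMap.exists_orthonormalBasis_inner_adjoint (𝕜 := 𝕜) (E := T) (F := S)
    (crossProjection S T) rfl
  rw [adjoint_crossProjection] at hv
  have := hN.diagonal_sin_eq S T v _
    (fun i j => (inner_crossProjection T S _ _).symm.trans (hv i j))
  rw [← this, sinTheta, numAngles, min_eq_left h]
  rfl

/-- For subspaces of equal dimension, `P_{Sᗮ} P_T` and `P_{Tᗮ} P_S` have equal norms. -/
theorem matNorm_projMap_comm (hN : IsUnitarilyInvariantNorm N) {S T : Submodule 𝕜 𝔼}
    (h : finrank 𝕜 S = finrank 𝕜 T) :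
    matNorm N (projMap Sᗮ ∘ₗ projMap T) = matNorm N (projMap Tᗮ ∘ₗ projMap S) := by
  rw [← hN.sinTheta_of_finrank_ge h.ge, hN.sinTheta_of_finrank_le h.le]

end IsUnitarilyInvariantNorm

end Norm

/-! ### Projection calculus and construction of the subspace -/

section Subspaces

variable {𝕜 : Type*} [RCLike 𝕜] {n : ℕ}

local notation "𝔼" => EuclideanSpace 𝕜 (Fin n)

theorem projMap_mem (K : Submodule 𝕜 𝔼) (x : 𝔼) : projMap K x ∈ K :=
  K.starProjection_apply_mem x

theorem projMap_eq_self {K : Submodule 𝕜 𝔼} {x : 𝔼} (hx : x ∈ K) : projMap K x = x :=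
  Submodule.starProjection_eq_self_iff.2 hx

theorem projMap_eq_of_sub_mem {K : Submodule 𝕜 𝔼} {x y : 𝔼} (hy : y ∈ K) (h : x - y ∈ Kᗮ) :
    projMap K x = y :=
  Submodule.eq_starProjection_of_mem_orthogonal hy h

theorem sub_projMap_mem (K : Submodule 𝕜 𝔼) (x : 𝔼) : x - projMap K x ∈ Kᗮ :=
  Submodule.sub_starProjection_mem_orthogonal x

theorem projMap_orthogonal_apply (K : Submodule 𝕜 𝔼) (x : 𝔼) :
    projMap Kᗮ x = x - projMap K x :=
  Submodule.starProjection_orthogonal_val x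

theorem projMap_orthogonal_eq_zero {K : Submodule 𝕜 𝔼} {x : 𝔼} (hx : x ∈ K) :
    projMap Kᗮ x = 0 := by
  rw [projMap_orthogonal_apply, projMap_eq_self hx, sub_self]

theorem projMap_comp_of_le {K L : Submodule 𝕜 𝔼} (h : K ≤ L) :
    projMap K ∘ₗ projMap L = projMap K := by
  ext1 x
  refine (projMap_eq_of_sub_mem (projMap_mem K _) ?_).symm
  rw [← sub_add_sub_cancel x (projMap L x)]
  exact add_mem (Submodule.orthogonal_le h (sub_projMap_mem L x)) (sub_projMap_mem K _)

theorem comp_projMap_of_le {K L : Submodule 𝕜 𝔼} (h : K ≤ L) :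
    projMap L ∘ₗ projMap K = projMap K :=
  LinearMap.ext fun x => projMap_eq_self (h (projMap_mem K x))

theorem projMap_add_orthogonal (K : Submodule 𝕜 𝔼) :
    projMap K + projMap Kᗮ = LinearMap.id := by
  ext1 x
  rw [LinearMap.add_apply, projMap_orthogonal_apply, add_sub_cancel, LinearMap.id_apply]

namespace IsUnitarilyInvariantNorm

variable {N : Matrix (Fin n) (Fin n) 𝕜 → ℝ}

theorem matNorm_mono_left (hN : IsUnitarilyInvariantNorm N) {K L : Submodule 𝕜 𝔼} (h : K ≤ L)
    (f : 𝔼 →ₗ[𝕜] 𝔼) : matNorm N (projMap K ∘ₗ f) ≤ matNorm N (projMap L ∘ₗ f) := by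
  rw [← projMap_comp_of_le h, LinearMap.comp_assoc]
  exact hN.matNorm_projMap_comp_le _ _

theorem matNorm_mono_right (hN : IsUnitarilyInvariantNorm N) {K L : Submodule 𝕜 𝔼} (h : K ≤ L)
    (f : 𝔼 →ₗ[𝕜] 𝔼) : matNorm N (f ∘ₗ projMap K) ≤ matNorm N (f ∘ₗ projMap L) := by
  rw [← comp_projMap_of_le h, ← LinearMap.comp_assoc]
  exact hN.matNorm_comp_projMap_le _ _

/-- A triangle inequality, through an intermediate subspace `M`. -/
theorem matNorm_triangle (hN : IsUnitarilyInvariantNorm N) (K L M : Submodule 𝕜 𝔼) :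
    matNorm N (projMap K ∘ₗ projMap L) ≤
      matNorm N (projMap K ∘ₗ projMap M) + matNorm N (projMap Mᗮ ∘ₗ projMap L) := by
  have h : projMap K ∘ₗ projMap L =
      (projMap K ∘ₗ projMap M) ∘ₗ projMap L + projMap K ∘ₗ (projMap Mᗮ ∘ₗ projMap L) := by
    rw [LinearMap.comp_assoc, ← LinearMap.comp_add, ← LinearMap.add_comp,
      projMap_add_orthogonal, LinearMap.id_comp]
  rw [h]
  exact (hN.matNorm_add_le _ _).trans
    (add_le_add (hN.matNorm_comp_projMap_le _ _) (hN.matNorm_projMap_comp_le _ _))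

/-- Projecting `T` to a subspace containing `P` does not increase the angles to `P`. -/
theorem matNorm_map_projMap_le (hN : IsUnitarilyInvariantNorm N) {P Q : Submodule 𝕜 𝔼}
    (hPQ : P ≤ Q) (T : Submodule 𝕜 𝔼) :
    matNorm N (projMap (T.map (projMap Q))ᗮ ∘ₗ projMap P) ≤
      matNorm N (projMap Tᗮ ∘ₗ projMap P) := by
  -- `P_Q` fixes `P`, and `P_Q P_T` has its range in `P_Q T`, which the outer projection kills.
  have h : projMap (T.map (projMap Q))ᗮ ∘ₗ projMap P =
      projMap (T.map (projMap Q))ᗮ ∘ₗ (projMap Q ∘ₗ (projMap Tᗮ ∘ₗ projMap P)) := by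
    ext1 x
    simp only [LinearMap.comp_apply]
    rw [projMap_orthogonal_apply T, map_sub, projMap_eq_self (hPQ (projMap_mem P x)), map_sub,
      projMap_orthogonal_eq_zero (Submodule.mem_map_of_mem (projMap_mem T _)), sub_zero]
  rw [h]
  exact (hN.matNorm_projMap_comp_le _ _).trans (hN.matNorm_projMap_comp_le _ _)

end IsUnitarilyInvariantNorm

/-- For `y ∈ T`, `P_Q y` lies in `P_Q T` and `y - P_Q y` is orthogonal to `Q ≥ P_Q T`, so both
projections of `y` agree. -/
theorem projMap_map_orthogonal_comp (Q T : Submodule 𝕜 𝔼) :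
    projMap (T.map (projMap Q))ᗮ ∘ₗ projMap T = projMap Qᗮ ∘ₗ projMap T := by
  ext1 x
  simp only [LinearMap.comp_apply]
  have hle : T.map (projMap Q) ≤ Q := Submodule.map_le_iff_le_comap.2 fun y _ => projMap_mem Q y
  rw [projMap_orthogonal_apply, projMap_orthogonal_apply,
    projMap_eq_of_sub_mem (Submodule.mem_map_of_mem (projMap_mem T x))
      (Submodule.orthogonal_le hle (sub_projMap_mem Q _))]

/-- A subspace `P` can be enlarged by vectors of `T` without changing `P_{Tᗮ} P_P`. -/
theorem exists_extension_projMap_orthogonal_eq (P T : Submodule 𝕜 𝔼) {m : ℕ}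
    (hP : finrank 𝕜 P ≤ m) (hT : m ≤ finrank 𝕜 T) :
    ∃ S : Submodule 𝕜 𝔼, P ≤ S ∧ S ≤ P ⊔ T ∧ finrank 𝕜 S = m ∧
      projMap Tᗮ ∘ₗ projMap S = projMap Tᗮ ∘ₗ projMap P := by
  -- Being orthogonal to `P` costs at most `dim P` dimensions of `T`.
  have hdim : m - finrank 𝕜 P ≤ finrank 𝕜 ↥(T ⊓ Pᗮ) := by
    have h1 := Submodule.finrank_sup_add_finrank_inf_eq T Pᗮ
    have h2 := Submodule.finrank_add_finrank_orthogonal P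
    have h3 := Submodule.finrank_le (T ⊔ Pᗮ)
    omega
  obtain ⟨R, -, hR, hRm⟩ := exists_submodule_between_finrank_eq (bot_le (a := T ⊓ Pᗮ))
    (by simp) hdim
  refine ⟨P ⊔ R, le_sup_left, sup_le_sup_left (hR.trans inf_le_left) P, ?_, ?_⟩
  · have h1 := Submodule.finrank_sup_add_finrank_inf_eq P R
    have h2 : P ⊓ R = ⊥ := by
      rw [eq_bot_iff, ← P.inf_orthogonal_eq_bot]
      exact inf_le_inf_left _ (hR.trans inf_le_right)
    rw [h2, finrank_bot] at h1
    omega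
  · ext1 x
    simp only [LinearMap.comp_apply]
    obtain ⟨p, hp, r, hr, hpr⟩ := Submodule.mem_sup.1 (projMap_mem (P ⊔ R) x)
    have hxp : projMap P x = p := by
      refine projMap_eq_of_sub_mem hp ?_
      have h1 : x - p = (x - projMap (P ⊔ R) x) + r := by rw [← hpr]; abel
      rw [h1]
      exact add_mem (Submodule.orthogonal_le le_sup_left (sub_projMap_mem _ x)) (hR hr).2
    rw [hxp, ← hpr, map_add, projMap_orthogonal_eq_zero (hR hr).1, add_zero]

/-- For `P ≤ Q` and `T` such that the angles between `Q` and `T` are acute, some subspace between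
`P` and `Q`, of any prescribed dimension, is close to `T`. -/
theorem exists_between_sinTheta_le {P Q T : Submodule 𝕜 𝔼} (hPQ : P ≤ Q) {h : ℕ}
    (hP : finrank 𝕜 P ≤ h) (hQ : h ≤ finrank 𝕜 Q)
    (hT : ∀ i < numAngles Q T, principalAngle Q T i < Real.pi / 2) :
    ∃ S : Submodule 𝕜 𝔼, finrank 𝕜 S = h ∧ P ≤ S ∧ S ≤ Q ∧
      ∀ N : Matrix (Fin n) (Fin n) 𝕜 → ℝ, IsUnitarilyInvariantNorm N →
        N (sinTheta S T) ≤ N (sinTheta P T) + N (sinTheta Q T) := by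
  obtain hTP | hPT := le_or_gt (finrank 𝕜 T) (finrank 𝕜 P)
  · obtain ⟨S, hPS, hSQ, hS⟩ := exists_submodule_between_finrank_eq hPQ hP hQ
    refine ⟨S, hS, hPS, hSQ, fun N hN => le_add_of_le_of_nonneg ?_ (hN.nonneg _)⟩
    rw [hN.sinTheta_of_finrank_ge hTP, hN.sinTheta_of_finrank_ge (by omega)]
    exact hN.matNorm_mono_left (Submodule.orthogonal_le hPS) _
  obtain hQT | hTQ := le_or_gt (finrank 𝕜 Q) (finrank 𝕜 T)
  · obtain ⟨S, hPS, hSQ, hS⟩ := exists_submodule_between_finrank_eq hPQ hP hQ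
    refine ⟨S, hS, hPS, hSQ, fun N hN => le_add_of_nonneg_of_le (hN.nonneg _) ?_⟩
    rw [hN.sinTheta_of_finrank_le hQT, hN.sinTheta_of_finrank_le (by omega)]
    exact hN.matNorm_mono_right hSQ _
  -- As `dim T < dim Q`, all `dim T` singular values are cosines of acute angles.
  have hinj : Function.Injective (crossProjection Q T) := by
    refine (LinearMap.injective_iff_forall_lt_finrank_singularValues_pos (𝕜 := 𝕜) (E := T)
      (F := Q) _).2 fun i hi => ?_
    exact Real.arccos_lt_pi_div_two.1 (hT i (by rw [numAngles]; omega))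
  obtain ⟨T', hT'⟩ : ∃ T', T' = T.map (projMap Q) := ⟨_, rfl⟩
  have hT'Q : T' ≤ Q := by
    rw [hT', Submodule.map_le_iff_le_comap]
    exact fun y _ => projMap_mem Q y
  have hdim : finrank 𝕜 T' = finrank 𝕜 T := by
    have h1 : T' = (T.map (projMap Q)) := hT'
    have h2 : Function.Injective (projMap Q ∘ₗ T.subtype) := fun x y hxy =>
      hinj (Subtype.ext hxy)
    rw [h1, ← Submodule.range_subtype T, ← LinearMap.range_comp]
    rw [LinearMap.finrank_range_of_inj h2, Submodule.range_subtype]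
  obtain ⟨S₀, hPS₀, hS₀, hS₀dim, hproj⟩ := exists_extension_projMap_orthogonal_eq P T'
    (m := min h (finrank 𝕜 T)) (by omega) (by omega)
  obtain ⟨S, hS₀S, hSQ, hS⟩ := exists_submodule_between_finrank_eq
    (hS₀.trans (sup_le hPQ hT'Q)) (h := h) (by omega) hQ
  refine ⟨S, hS, hPS₀.trans hS₀S, hSQ, fun N hN => ?_⟩
  have hPle := hN.matNorm_map_projMap_le hPQ T
  rw [← hT', ← hproj, ← hN.sinTheta_of_finrank_le hPT.le] at hPle
  have hQeq : matNorm N (projMap T'ᗮ ∘ₗ projMap T) = N (sinTheta Q T) := by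
    rw [hN.sinTheta_of_finrank_ge hTQ.le, hT', projMap_map_orthogonal_comp]
  obtain hhT | hTh := le_or_gt h (finrank 𝕜 T)
  · have hSS₀ : S₀ = S := Submodule.eq_of_le_of_finrank_eq hS₀S (by omega)
    rw [hSS₀] at hPle
    rw [hN.sinTheta_of_finrank_le (by omega), add_comm]
    refine (hN.matNorm_triangle _ _ T').trans (add_le_add ?_ hPle)
    rw [hN.matNorm_projMap_comm hdim.symm, hQeq]
  · rw [hN.sinTheta_of_finrank_ge (by omega)]
    refine (hN.matNorm_triangle _ _ T').trans (add_le_add ?_ hQeq.le)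
    -- `S₀` has the dimension of `T'`, so the two factors can be swapped for `S₀`, though not for
    -- `S`.
    refine (hN.matNorm_mono_left (Submodule.orthogonal_le hS₀S) _).trans ?_
    rw [hN.matNorm_projMap_comm (by omega)]
    exact hPle

/-! ### Leading spans and the main theorem -/

theorem finrank_leadingSpan {X : Matrix (Fin n) (Fin n) 𝕜} (hX : X ∈ Matrix.unitaryGroup (Fin n) 𝕜)
    {l : ℕ} (hl : l ≤ n) : finrank 𝕜 (leadingSpan X l) = l := by
  have hli : LinearIndependent 𝕜 fun i : Fin n => (WithLp.toLp 2 (X.col i) : 𝔼) := by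
    have h1 : LinearIndependent 𝕜 X.col :=
      Matrix.linearIndependent_cols_iff_isUnit.2 (Unitary.toUnits ⟨X, hX⟩).isUnit
    exact h1.map' (WithLp.linearEquiv 2 𝕜 (Fin n → 𝕜)).symm.toLinearMap (LinearEquiv.ker _)
  have h2 := hli.comp (Fin.castLE hl) (Fin.castLE_injective hl)
  have h3 : {x : 𝔼 | ∃ i : Fin n, (i : ℕ) < l ∧ x = WithLp.toLp 2 (X.col i)} =
      Set.range ((fun i : Fin n => (WithLp.toLp 2 (X.col i) : 𝔼)) ∘ Fin.castLE hl) := by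
    ext x
    constructor
    · rintro ⟨i, hi, rfl⟩
      exact ⟨⟨i, hi⟩, rfl⟩
    · rintro ⟨i, rfl⟩
      exact ⟨Fin.castLE hl i, i.2, rfl⟩
  rw [leadingSpan, h3, finrank_span_eq_card h2, Fintype.card_fin]

theorem leadingSpan_mono (X : Matrix (Fin n) (Fin n) 𝕜) {l m : ℕ} (h : l ≤ m) :
    leadingSpan X l ≤ leadingSpan X m :=
  Submodule.span_mono fun _ ⟨i, hi, hx⟩ => ⟨i, hi.trans_le h, hx⟩

end Subspaces

theorem mainTheorem1 {𝕜 : Type*} [RCLike 𝕜] {n : ℕ}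
    (A X : Matrix (Fin n) (Fin n) 𝕜) (lam : Fin n → ℝ)
    (hA : A.IsHermitian) (hX : IsEigendecomposition A X lam)
    (j h k : ℕ) (hjh : j < h) (hhk : h < k) (hkn : k ≤ n)
    (hgapj : HasEigenGap lam j) (hgapk : HasEigenGap lam k)
    (T : Submodule 𝕜 (EuclideanSpace 𝕜 (Fin n)))
    (hT : ∀ i < numAngles (leadingSpan X k) T,
      principalAngle (leadingSpan X k) T i < Real.pi / 2) :
    (∀ N : Matrix (Fin n) (Fin n) 𝕜 → ℝ, IsUnitarilyInvariantNorm N →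
      classDist N (admissibleSubspaces X j h k) T
        ≤ N (sinTheta (leadingSpan X j) T) + N (sinTheta (leadingSpan X k) T)) ∧
    (∃ S ∈ admissibleSubspaces X j h k,
      ∀ N : Matrix (Fin n) (Fin n) 𝕜 → ℝ, IsUnitarilyInvariantNorm N →
        N (sinTheta S T)
          ≤ N (sinTheta (leadingSpan X j) T) + N (sinTheta (leadingSpan X k) T)) := by
  obtain ⟨S, hS, hjS, hSk, hle⟩ := exists_between_sinTheta_le
    (leadingSpan_mono X (hjh.trans hhk).le) (h := h)
    (by rw [finrank_leadingSpan hX.unitary (by omega)]; exact hjh.le)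
    (by rw [finrank_leadingSpan hX.unitary hkn]; exact hhk.le) hT
  have hmem : S ∈ admissibleSubspaces X j h k := ⟨hS, hjS, hSk⟩
  refine ⟨fun N hN => ?_, S, hmem, hle⟩
  refine (csInf_le ⟨0, ?_⟩ (Set.mem_image_of_mem _ hmem)).trans (hle N hN)
  rintro _ ⟨S', -, rfl⟩
  exact hN.nonneg _
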